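/- Let $T$ be a locally finite tree with root $v$, and let $v_1,\dots,v_n$ be the children (neighbours) of $v$, where $n\ge 2$. For each $i$ let $T_i$ be the subtree rooted at $v_i$, i.e. the subgraph of $T$ induced on the vertices $w$ such that the path in $T$ from $v$ to $w$ passes through $v_i$. Suppose that, for every $i$, the simple random walk on $T_i$ is transient. Then the Poisson boundary of the simple random walk on $T$ is nontrivial: for every starting vertex $x$, if $P_x$ denotes the law on the space $V(T)^{\mathbb{Z}_{\ge 0}}$ of trajectories of the simple random walk on $T$ started at $x$, there is a measurable set $A$ of trajectories that is invariant under the time shift $(Z_k)_{k\ge 0}\mapsto (Z_{k+1})_{k\ge 0}$ and satisfies $0<P_x(A)<1$. -/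

import Mathlib

namespace TreeWalk

open MeasureTheory ProbabilityTheory

/-- Induced subgraphs of locally finite graphs are locally finite. -/
noncomputable instance induceLocallyFinite {V : Type*} (G : SimpleGraph V) [G.LocallyFinite]
    (s : Set V) : (G.induce s).LocallyFinite := fun x =>
  Fintype.ofInjective
    (fun y : (G.induce s).neighborSet x => (⟨y.1.1, y.2⟩ : G.neighborSet x.1))
    (fun _ _ h => Subtype.ext (Subtype.ext (congrArg (fun z => z.1) h)))

/-- A subset of a discrete measurable space is a discrete measurable space. -/
instance subtypeDiscrete {V : Type*} [MeasurableSpace V] [DiscreteMeasurableSpace V] (s : Set V) :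
    DiscreteMeasurableSpace s :=
  ⟨fun t => ⟨Subtype.val '' t, MeasurableSet.of_discrete,
    Set.preimage_image_eq t Subtype.val_injective⟩⟩

section Walk

variable {V : Type*} (G : SimpleGraph V) [G.LocallyFinite]

open Classical in
/-- One step of the simple random walk from `x`: a uniformly chosen neighbour of `x`.
At an isolated vertex the walk stays put. -/
noncomputable def step (x : V) : PMF V :=
  if h : (G.neighborFinset x).Nonempty then PMF.uniformOfFinset (G.neighborFinset x) h
  else PMF.pure x

variable [MeasurableSpace V] [DiscreteMeasurableSpace V]

/-- The transition kernel of the simple random walk. -/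
noncomputable def stepKernel : Kernel V V where
  toFun x := (step G x).toMeasure
  measurable' := Measurable.of_discrete

instance : IsMarkovKernel (stepKernel G) :=
  ⟨fun x => inferInstanceAs (IsProbabilityMeasure (step G x).toMeasure)⟩

/-- The law of `Z_{n+1}` given `(Z_0, …, Z_n)`: one step of the walk from `Z_n`. -/
noncomputable def transition (n : ℕ) : Kernel (Finset.Iic n → V) V :=
  (stepKernel G).comap (fun z => z ⟨n, Finset.mem_Iic.2 le_rfl⟩) (measurable_pi_apply _)

instance (n : ℕ) : IsMarkovKernel (transition G n) := by
  unfold transition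
  infer_instance

/-- The law, on the trajectory space `V^ℕ` with the product σ-algebra, of the simple random
walk on `G` started at `x`. -/
noncomputable def law (x : V) : Measure (ℕ → V) :=
  Kernel.traj (X := fun _ => V) (transition G) 0 (fun _ => x)

/-- The simple random walk on `G` is transient: from every vertex, the probability of ever
returning to it is less than one. -/
def Transient : Prop :=
  ∀ x : V, law G x {z | ∃ n : ℕ, 1 ≤ n ∧ z n = x} < 1

/-- The time shift on trajectories. -/
def shift (z : ℕ → V) : ℕ → V := fun n => z (n + 1)

/-- The boundary of the simple random walk on `G` started at `x` is the space of ergodic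
components of the time shift on `(V^ℕ, law G x)`, that is, the quotient of that space determined
by the σ-algebra of shift-invariant events. It is nontrivial when this σ-algebra contains an event
whose probability is neither `0` nor `1`. -/
def BoundaryNontrivial (x : V) : Prop :=
  ∃ A : Set (ℕ → V), MeasurableSet[MeasurableSpace.invariants (shift (V := V))] A ∧
    0 < law G x A ∧ law G x A < 1

end Walk

/-- The vertex set of the subtree rooted at `u` of a tree `G` with root `r`: the vertices `w`
such that the path from `r` to `w` passes through `u`. -/
def descendants {V : Type*} (G : SimpleGraph V) (r u : V) : Set V :=
  {w | ∀ p : G.Walk r w, p.IsPath → u ∈ p.support}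

end TreeWalk

/-!
By transience of the subtree `T_i`, the walk on `T_i` started at some vertex avoids the root `v_i`
of `T_i` forever with positive probability. Until it visits `v_i` this walk takes the same steps as
the walk on `T`, because only `v_i` has neighbours outside `T_i`; hence the walk on `T` stays in
`T_i` forever with positive probability from some vertex. The event of being eventually in `T_i` is
shift-invariant, so by irreducibility it has positive probability from every vertex. The events
belonging to two different subtrees are disjoint, so neither of them has probability one.
-/

namespace TreeWalk

open MeasureTheory ProbabilityTheory Filter
open Preorder (frestrictLe)

section IonescuTulcea

variable {X : ℕ → Type*} [∀ n, MeasurableSpace (X n)]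

lemma exists_measurable_comp_eq_frestrictLe_succ (n : ℕ) :
    ∃ glue : (Π i : Finset.Iic n, X i) × X (n + 1) → Π i : Finset.Iic (n + 1), X i,
      Measurable glue ∧
        frestrictLe (n + 1) = glue ∘ fun z : Π n, X n => (frestrictLe n z, z (n + 1)) := by
  refine ⟨IicProdIoc n (n + 1) ∘ Prod.map id (MeasurableEquiv.piSingleton n), by fun_prop, ?_⟩
  ext z ⟨i, hi⟩
  by_cases h : i ≤ n
  · simp [IicProdIoc, h]
  · obtain rfl : i = n + 1 := by grind
    simp [IicProdIoc, MeasurableEquiv.piSingleton]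

variable {κ : (n : ℕ) → Kernel (Π i : Finset.Iic n, X i) (X (n + 1))} [∀ n, IsMarkovKernel (κ n)]

lemma eq_traj_of_map_eq_compProd {a : ℕ} {x : Π i : Finset.Iic a, X i} {μ : Measure (Π n, X n)}
    (h_init : μ.map (frestrictLe a) = Measure.dirac x)
    (h_succ : ∀ n ≥ a, μ.map (fun z => (frestrictLe n z, z (n + 1))) =
      μ.map (frestrictLe n) ⊗ₘ κ n) :
    μ = Kernel.traj κ a x := by
  have h_map (n : ℕ) (hn : a ≤ n) : μ.map (frestrictLe n) = Kernel.partialTraj κ a n x := by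
    induction n, hn using Nat.le_induction with
    | base => rw [h_init, Kernel.partialTraj_self, Kernel.id_apply]
    | succ n hn ih =>
      obtain ⟨glue, hglue, h_eq⟩ := exists_measurable_comp_eq_frestrictLe_succ (X := X) n
      rw [← Kernel.traj_map_frestrictLe_apply, h_eq, ← Measure.map_map hglue (by fun_prop),
        ← Measure.map_map hglue (by fun_prop), h_succ n hn, ih,
        Kernel.partialTraj_compProd_eq_map_traj hn]
  refine ((Kernel.isProjectiveLimit_trajFun κ a x).unique ?_).symm
  rw [isProjectiveLimit_nat_iff' (Kernel.isProjectiveMeasureFamily_partialTraj κ x) _ a]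
  intro n hn
  rw [inducedFamily_Iic, h_map n hn]

end IonescuTulcea

lemma measurable_shift {X : Type*} [MeasurableSpace X] : Measurable (shift (V := X)) :=
  measurable_pi_lambda _ fun n => measurable_pi_apply (n + 1)

section MarkovChain

variable {X : Type*} [MeasurableSpace X] (κ : Kernel X X) [IsMarkovKernel κ]

/-- The law of `Z_{n+1}` given `(Z_0, …, Z_n)` for the Markov chain with transition kernel `κ`. -/
noncomputable def chainTransition (n : ℕ) : Kernel (Finset.Iic n → X) X :=
  κ.comap (fun z => z ⟨n, Finset.mem_Iic.2 le_rfl⟩) (measurable_pi_apply _)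

instance (n : ℕ) : IsMarkovKernel (chainTransition κ n) := by
  unfold chainTransition
  infer_instance

/-- The Markov chain with transition kernel `κ`, as the kernel sending a starting point to the law
of the trajectory. -/
noncomputable def chain : Kernel X (ℕ → X) :=
  (Kernel.traj (X := fun _ => X) (chainTransition κ) 0).comap (fun x _ => x)
    (measurable_pi_lambda _ fun _ => measurable_id)

instance : IsMarkovKernel (chain κ) := by
  unfold chain
  infer_instance

lemma map_prodMap_compProd_comap {Y Z W : Type*} [MeasurableSpace Y] [MeasurableSpace Z]
    [MeasurableSpace W] {f : Y → Z} (hf : Measurable f) (μ : Measure Y) [SFinite μ]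
    (η : Kernel Z W) [IsSFiniteKernel η] :
    (μ ⊗ₘ η.comap f hf).map (Prod.map f id) = μ.map f ⊗ₘ η := by
  ext s hs
  rw [Measure.map_apply (by fun_prop) hs, Measure.compProd_apply (hs.preimage (by fun_prop)),
    Measure.compProd_apply hs, lintegral_map (Kernel.measurable_kernel_prodMk_left hs) hf]
  rfl

lemma chain_map_zero : (chain κ).map (fun z => z 0) = Kernel.id := by
  ext1 x
  have h := Kernel.traj_map_frestrictLe_apply (X := fun _ => X) (κ := chainTransition κ) 0 0
    fun _ => x
  rw [Kernel.partialTraj_self, Kernel.id_apply] at h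
  have h0 := congrArg (Measure.map fun w : Finset.Iic 0 → X => w ⟨0, Finset.mem_Iic.2 le_rfl⟩) h
  rw [Measure.map_map (by fun_prop) (by fun_prop), Measure.map_dirac' (by fun_prop)] at h0
  rwa [Kernel.map_apply _ (by fun_prop)]

lemma ae_chain_zero_mem {B : Set X} (hB : MeasurableSet B) {x : X} (hx : x ∈ B) :
    ∀ᵐ z ∂chain κ x, z 0 ∈ B := by
  refine ae_of_ae_map (f := fun z : ℕ → X => z 0) (measurable_pi_apply 0).aemeasurable ?_
  rw [← Kernel.map_apply _ (by fun_prop), chain_map_zero, Kernel.id_apply]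
  exact (ae_dirac_iff hB).2 hx

lemma traj_one_map_shift (w : Finset.Iic 1 → X) :
    (Kernel.traj (X := fun _ => X) (chainTransition κ) 1 w).map shift =
      chain κ (w ⟨1, Finset.mem_Iic.2 le_rfl⟩) := by
  let tail (n : ℕ) (w : Finset.Iic (n + 1) → X) : Finset.Iic n → X :=
    fun i => w ⟨i + 1, by grind⟩
  have h_tail (n : ℕ) : Measurable (tail n) :=
    measurable_pi_lambda _ fun _ => measurable_pi_apply _
  have h_shift (n : ℕ) : frestrictLe n ∘ shift = tail n ∘ frestrictLe (π := fun _ => X) (n + 1) :=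
    rfl
  have h_map_shift (n : ℕ) (μ : Measure (ℕ → X)) : (μ.map shift).map (frestrictLe n) =
      (μ.map (frestrictLe (n + 1))).map (tail n) := by
    rw [Measure.map_map (by fun_prop) measurable_shift, h_shift,
      Measure.map_map (h_tail n) (by fun_prop)]
  refine eq_traj_of_map_eq_compProd ?_ fun n _ => ?_
  · rw [h_map_shift, Kernel.traj_map_frestrictLe_apply, Kernel.partialTraj_self, Kernel.id_apply,
      Measure.map_dirac' (h_tail 0)]
    congr 1
    ext ⟨i, hi⟩
    obtain rfl : i = 0 := by grind
    rfl
  · have h_pair : (fun z : ℕ → X => (frestrictLe n z, z (n + 1))) ∘ shift =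
        Prod.map (tail n) id ∘ fun z => (frestrictLe (n + 1) z, z (n + 1 + 1)) := rfl
    rw [Measure.map_map (by fun_prop) measurable_shift, h_pair,
      ← Measure.map_map ((h_tail n).prodMap measurable_id) (by fun_prop),
      ← Kernel.partialTraj_compProd_eq_map_traj (Nat.le_add_left 1 n), h_map_shift,
      Kernel.traj_map_frestrictLe_apply, ← map_prodMap_compProd_comap (h_tail n)]
    rfl

-- The Markov property at time one.
theorem chain_map_shift : (chain κ).map shift = chain κ ∘ₖ κ := by
  let traj (n : ℕ) := Kernel.traj (X := fun _ => X) (chainTransition κ) n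
  let oneStep := Kernel.partialTraj (X := fun _ => X) (chainTransition κ) 0 1
  let last (w : Finset.Iic 1 → X) : X := w ⟨1, Finset.mem_Iic.2 le_rfl⟩
  have h_last : Measurable last := measurable_pi_apply _
  have h_traj_one : (traj 1).map shift = (chain κ).comap last h_last := by
    ext1 w
    rw [Kernel.map_apply _ measurable_shift, Kernel.comap_apply]
    exact traj_one_map_shift κ w
  ext1 x
  calc (chain κ).map shift x
      = (traj 0).map shift fun _ => x := by
        rw [Kernel.map_apply _ measurable_shift, Kernel.map_apply _ measurable_shift]; rfl
    _ = (traj 1 ∘ₖ oneStep).map shift fun _ => x := by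
        rw [Kernel.traj_comp_partialTraj zero_le_one]
    _ = (chain κ ∘ₖ oneStep.map last) fun _ => x := by
        rw [Kernel.map_comp, h_traj_one, Kernel.comp_map _ _ h_last]
    _ = (chain κ ∘ₖ chainTransition κ 0) fun _ => x := by
        rw [Kernel.map_partialTraj_succ_self]
    _ = (chain κ ∘ₖ κ) x := by
        rw [Kernel.comp_apply, Kernel.comp_apply]; rfl

lemma chain_preimage_shift {A : Set (ℕ → X)} (hA : MeasurableSet A) (x : X) :
    chain κ x (shift ⁻¹' A) = ∫⁻ y, chain κ y A ∂κ x := by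
  rw [← Kernel.map_apply' _ measurable_shift _ hA, chain_map_shift, Kernel.comp_apply' _ _ _ hA]

lemma ae_chain_eq_zero_of_invariant {A : Set (ℕ → X)} (hA : MeasurableSet A)
    (hA_inv : shift ⁻¹' A = A) {x : X} (hx : chain κ x A = 0) : ∀ᵐ y ∂κ x, chain κ y A = 0 := by
  rw [← hA_inv, chain_preimage_shift κ hA] at hx
  exact (lintegral_eq_zero_iff ((chain κ).measurable_coe hA)).1 hx

lemma exists_chain_avoiding_ne_zero {B : Set X} (hB : MeasurableSet B) {x : X}
    (hx : chain κ x {z | ∃ n, 1 ≤ n ∧ z n ∈ B} < 1) :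
    ∃ y, chain κ y (Set.univ.pi fun _ => Bᶜ) ≠ 0 := by
  by_contra! h_null
  have h_meas : MeasurableSet (Set.univ.pi fun _ : ℕ => Bᶜ) := .univ_pi fun _ => hB.compl
  have h_hit : {z : ℕ → X | ∃ n, 1 ≤ n ∧ z n ∈ B} = shift ⁻¹' (Set.univ.pi fun _ => Bᶜ)ᶜ := by
    ext z
    simp only [shift, Set.mem_ofPred_eq, Set.mem_preimage, Set.mem_compl_iff, Set.mem_univ_pi,
      not_forall, not_not]
    exact ⟨fun ⟨n, hn, hz⟩ => ⟨n - 1, by rwa [Nat.sub_add_cancel hn]⟩,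
      fun ⟨n, hz⟩ => ⟨n + 1, n.succ_pos, hz⟩⟩
  have h_one (y : X) : chain κ y (Set.univ.pi fun _ => Bᶜ)ᶜ = 1 := by
    rw [prob_compl_eq_one_iff h_meas, h_null y]
  rw [h_hit, chain_preimage_shift κ h_meas.compl] at hx
  simp [h_one] at hx

lemma chain_pi_Iio_succ_of_mem {B : Set X} (hB : MeasurableSet B) (n : ℕ) {x : X} (hx : x ∈ B) :
    chain κ x ((Set.Iio (n + 1)).pi fun _ => B) =
      ∫⁻ y, chain κ y ((Set.Iio n).pi fun _ => B) ∂κ x := by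
  rw [← chain_preimage_shift κ (.pi (Set.to_countable _) fun _ _ => hB)]
  refine measure_congr ?_
  filter_upwards [ae_chain_zero_mem κ hB hx] with z hz
  exact propext ⟨fun h i hi => h (i + 1) (Nat.succ_lt_succ hi),
    fun h i hi => i.casesOn (fun _ => hz) (fun i hi => h i (Nat.lt_of_succ_lt_succ hi)) hi⟩

lemma chain_pi_Iio_succ_of_notMem {B : Set X} (hB : MeasurableSet B) (n : ℕ) {x : X}
    (hx : x ∉ B) : chain κ x ((Set.Iio (n + 1)).pi fun _ => B) = 0 :=
  measure_mono_null (fun _ hz => not_not.2 (hz 0 n.succ_pos)) (ae_chain_zero_mem κ hB.compl hx)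

lemma chain_univ_pi_eq_iInf {B : Set X} (hB : MeasurableSet B) (x : X) :
    chain κ x (Set.univ.pi fun _ => B) = ⨅ n, chain κ x ((Set.Iio n).pi fun _ => B) := by
  rw [← Set.iUnion_Iio, Set.pi_iUnion_eq_iInter_pi]
  exact Antitone.measure_iInter
    (fun _ _ hmn => Set.pi_mono' (fun _ _ => subset_rfl) (Set.Iio_subset_Iio hmn))
    (fun n => (MeasurableSet.pi (Set.to_countable _) fun _ _ => hB).nullMeasurableSet)
    ⟨0, measure_ne_top _ _⟩

variable {κ} in
theorem chain_univ_pi_preimage {Y : Type*} [MeasurableSpace Y] {η : Kernel Y Y} [IsMarkovKernel η]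
    {f : Y → X} (hf : Measurable f) {B : Set X} (hB : MeasurableSet B)
    (h_map : ∀ y, f y ∈ B → (η y).map f = κ (f y)) (y : Y) :
    chain η y (Set.univ.pi fun _ => f ⁻¹' B) = chain κ (f y) (Set.univ.pi fun _ => B) := by
  rw [chain_univ_pi_eq_iInf η (hf hB), chain_univ_pi_eq_iInf κ hB]
  congr with n
  induction n generalizing y with
  | zero => simp
  | succ n ih =>
    by_cases hy : f y ∈ B
    · rw [chain_pi_Iio_succ_of_mem η (hf hB) n hy, chain_pi_Iio_succ_of_mem κ hB n hy,
        ← h_map y hy, lintegral_map ((chain κ).measurable_coe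
          (.pi (Set.to_countable _) fun _ _ => hB)) hf]
      simp only [ih]
    · rw [chain_pi_Iio_succ_of_notMem η (hf hB) n hy, chain_pi_Iio_succ_of_notMem κ hB n hy]

end MarkovChain

section EventuallyIn

variable {V : Type*}

/-- The trajectories that are eventually in `s`. -/
def eventuallyIn (s : Set V) : Set (ℕ → V) := {z | ∀ᶠ n in atTop, z n ∈ s}

lemma shift_preimage_eventuallyIn (s : Set V) : shift ⁻¹' eventuallyIn s = eventuallyIn s := by
  ext z
  conv_rhs => rw [eventuallyIn, Set.mem_ofPred_eq, ← map_add_atTop_eq_nat 1]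
  rfl

lemma disjoint_eventuallyIn {s t : Set V} (h : Disjoint s t) :
    Disjoint (eventuallyIn s) (eventuallyIn t) := by
  rw [Set.disjoint_left]
  intro z hs ht
  obtain ⟨n, hn⟩ := (hs.and ht).exists
  exact h.notMem_of_mem_left hn.1 hn.2

lemma measurableSet_eventuallyIn [MeasurableSpace V] {s : Set V} (hs : MeasurableSet s) :
    MeasurableSet (eventuallyIn s) := by
  let visits (n : ℕ) : Set (ℕ → V) := {z | z n ∈ s}
  have h_liminf : eventuallyIn s = liminf visits atTop :=
    Set.ext fun _ => (mem_liminf_iff_eventually_mem (s := visits)).symm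
  rw [h_liminf]
  exact MeasurableSet.measurableSet_liminf fun n => measurable_pi_apply n hs

end EventuallyIn

section Descendants

variable {V : Type*} {G : SimpleGraph V} {r u u' w w' : V}

lemma exists_adj_ne_of_two_le_degree [Fintype (G.neighborSet r)] (h : 2 ≤ G.degree r) :
    ∃ u u', G.Adj r u ∧ G.Adj r u' ∧ u ≠ u' := by
  obtain ⟨u, hu, u', hu', hne⟩ := Finset.one_lt_card.1 h
  rw [SimpleGraph.mem_neighborFinset] at hu hu'
  exact ⟨u, u', hu, hu', hne⟩

lemma self_mem_descendants : u ∈ descendants G r u := fun p _ => p.end_mem_support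

lemma notMem_descendants_of_adj (h : G.Adj r u) (hr : r ≠ u') (hne : u ≠ u') :
    u ∉ descendants G r u' := by
  intro hu
  have h_edge : u' ∈ h.toWalk.support := hu h.toWalk (.of_adj h)
  simp [hr.symm, hne.symm] at h_edge

lemma mem_support_of_mem_descendants (hw : w ∈ descendants G r u) (p : G.Walk r w) :
    u ∈ p.support := by
  classical exact p.support_bypass_subset_support (hw p.bypass p.bypass_isPath)

lemma mem_descendants_of_adj (hw : w ∈ descendants G r u) (hne : w ≠ u) (h : G.Adj w w') :
    w' ∈ descendants G r u := by
  intro p _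
  have h_concat : u ∈ (p.concat h.symm).support := mem_support_of_mem_descendants hw _
  rw [SimpleGraph.Walk.support_concat, List.mem_append, List.mem_singleton] at h_concat
  exact h_concat.resolve_right hne.symm

-- A geodesic from `u'` to `w` has to enter the subtree rooted at `u` through `u`.
lemma dist_lt_dist_of_mem_descendants (hw : w ∈ descendants G r u) (hu' : u' ∉ descendants G r u)
    (h : G.Reachable u' w) : G.dist u w < G.dist u' w := by
  classical
  obtain ⟨p, hp⟩ := h.exists_walk_length_eq_dist
  obtain ⟨q, _, hq⟩ : ∃ q : G.Walk r u', q.IsPath ∧ u ∉ q.support := by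
    simpa [descendants] using hu'
  have hup : u ∈ p.support :=
    ((q.mem_support_append_iff p).1 (mem_support_of_mem_descendants hw _)).resolve_left hq
  calc G.dist u w ≤ (p.dropUntil u hup).length := SimpleGraph.dist_le _
    _ < p.length := SimpleGraph.Walk.length_dropUntil_lt_length hup
        (ne_of_mem_of_not_mem self_mem_descendants hu')
    _ = G.dist u' w := hp

lemma disjoint_descendants (hG : G.Preconnected) (hu : u ∉ descendants G r u')
    (hu' : u' ∉ descendants G r u) : Disjoint (descendants G r u) (descendants G r u') :=
  Set.disjoint_left.2 fun w hw hw' =>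
    (dist_lt_dist_of_mem_descendants hw hu' (hG u' w)).asymm
      (dist_lt_dist_of_mem_descendants hw' hu (hG u w))

end Descendants

section SimpleRandomWalk

lemma map_uniformOfFinset_embedding {X Y : Type*} {t : Finset X} (ht : t.Nonempty) (f : X ↪ Y) :
    (PMF.uniformOfFinset t ht).map f = PMF.uniformOfFinset (t.map f) (ht.map (f := f)) := by
  classical
  ext y
  by_cases hy : y ∈ Set.range f
  · obtain ⟨x, rfl⟩ := hy
    rw [PMF.map_apply, tsum_eq_single x (by simp +contextual [f.injective.eq_iff, eq_comm])]
    simp [PMF.uniformOfFinset_apply]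
  · have h_ne (x : X) : y ≠ f x := fun h => hy ⟨x, h.symm⟩
    have hy_map : y ∉ t.map f := by simp [(h_ne _).symm]
    rw [PMF.uniformOfFinset_apply_of_notMem _ hy_map]
    simp [PMF.map_apply, h_ne]

variable {V : Type*} (G : SimpleGraph V) [G.LocallyFinite]

lemma step_apply_ne_zero {x y : V} (h : G.Adj x y) : step G x y ≠ 0 := by
  have hy : y ∈ G.neighborFinset x := by simpa using h
  have hne : (G.neighborFinset x).Nonempty := ⟨y, hy⟩
  rw [step, dif_pos hne, PMF.uniformOfFinset_apply_of_mem hne hy]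
  simp

lemma map_step_induce {s : Set V} (x : s) (hx : G.neighborSet x ⊆ s) :
    (step (G.induce s) x).map Subtype.val = step G x := by
  have h_map : ((G.induce s).neighborFinset x).map (Function.Embedding.subtype _) =
      G.neighborFinset x := by
    ext y
    simpa using fun h => hx h
  by_cases hne : (G.neighborFinset x).Nonempty
  · have hne_induce : ((G.induce s).neighborFinset x).Nonempty := by
      rwa [← h_map, Finset.map_nonempty] at hne
    rw [step, step, dif_pos hne, dif_pos hne_induce]
    simp only [← h_map]
    exact map_uniformOfFinset_embedding hne_induce (Function.Embedding.subtype _)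
  · have h_isolated : ¬((G.induce s).neighborFinset x).Nonempty := by
      rwa [← h_map, Finset.map_nonempty] at hne
    rw [step, step, dif_neg hne, dif_neg h_isolated, PMF.pure_map]

variable [MeasurableSpace V] [DiscreteMeasurableSpace V]

lemma law_eq_chain (x : V) : law G x = chain (stepKernel G) x := rfl

instance (x : V) : IsProbabilityMeasure (law G x) := by
  rw [law_eq_chain]
  infer_instance

lemma law_eq_zero_of_adj {A : Set (ℕ → V)} (hA : MeasurableSet A) (hA_inv : shift ⁻¹' A = A)
    {x y : V} (h : G.Adj x y) (hx : law G x A = 0) : law G y A = 0 := by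
  have h_ae := ae_chain_eq_zero_of_invariant (stepKernel G) hA hA_inv hx
  by_contra hy
  refine step_apply_ne_zero G h ?_
  rw [← PMF.toMeasure_apply_singleton _ y (measurableSet_singleton y)]
  exact measure_mono_null (Set.singleton_subset_iff.2 hy) h_ae

lemma law_eq_zero_of_reachable {A : Set (ℕ → V)} (hA : MeasurableSet A) (hA_inv : shift ⁻¹' A = A)
    {x y : V} (h : G.Reachable x y) (hx : law G x A = 0) : law G y A = 0 := by
  obtain ⟨p⟩ := h
  induction p with
  | nil => exact hx
  | cons h _ ih => exact ih (law_eq_zero_of_adj G hA hA_inv h hx)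

lemma law_induce_univ_pi {s B : Set V} (hB : ∀ x ∈ B, G.neighborSet x ⊆ s) (x : s) :
    law (G.induce s) x (Set.univ.pi fun _ => Subtype.val ⁻¹' B) =
      law G x (Set.univ.pi fun _ => B) := by
  refine chain_univ_pi_preimage measurable_subtype_coe .of_discrete (fun y hy => ?_) x
  change (step (G.induce s) y).toMeasure.map Subtype.val = (step G y).toMeasure
  rw [PMF.toMeasure_map _ _ measurable_subtype_coe, map_step_induce G y (hB y hy)]

variable {G}

lemma Transient.exists_law_avoiding_ne_zero (hG : Transient G) (x : V) :
    ∃ y, law G y (Set.univ.pi fun _ => {x}ᶜ) ≠ 0 :=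
  exists_chain_avoiding_ne_zero (stepKernel G) (measurableSet_singleton x) (hG x)

lemma law_eventuallyIn_pos (hG : G.Preconnected) {s : Set V} {u : V} (hu : u ∈ s)
    (h_exit : ∀ w ∈ s, w ≠ u → G.neighborSet w ⊆ s) (hs : Transient (G.induce s)) (x : V) :
    0 < law G x (eventuallyIn s) := by
  obtain ⟨y, hy⟩ := hs.exists_law_avoiding_ne_zero ⟨u, hu⟩
  have h_preimage : ({⟨u, hu⟩}ᶜ : Set s) = Subtype.val ⁻¹' (s \ {u}) := by
    ext w
    simp [Subtype.ext_iff]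
  rw [h_preimage, law_induce_univ_pi G fun w hw => h_exit w hw.1 hw.2] at hy
  refine pos_iff_ne_zero.2 fun hx => hy (measure_mono_null (t := eventuallyIn s) ?_ ?_)
  · exact fun z hz => .of_forall fun n => (hz n trivial).1
  · exact law_eq_zero_of_reachable G (measurableSet_eventuallyIn .of_discrete)
      (shift_preimage_eventuallyIn s) (hG x y) hx

lemma boundaryNontrivial_of_disjoint {s t : Set V} (hst : Disjoint s t) {x : V}
    (hs : 0 < law G x (eventuallyIn s)) (ht : 0 < law G x (eventuallyIn t)) :
    BoundaryNontrivial G x := by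
  have h_meas (s : Set V) : MeasurableSet (eventuallyIn s) :=
    measurableSet_eventuallyIn .of_discrete
  refine ⟨eventuallyIn s, ⟨h_meas s, shift_preimage_eventuallyIn s⟩, hs, ?_⟩
  calc law G x (eventuallyIn s)
      ≤ law G x (eventuallyIn t)ᶜ := measure_mono (disjoint_eventuallyIn hst).subset_compl_right
    _ = 1 - law G x (eventuallyIn t) := prob_compl_eq_one_sub (h_meas t)
    _ < 1 := ENNReal.sub_lt_self ENNReal.one_ne_top one_ne_zero ht.ne'

end SimpleRandomWalk

end TreeWalk

open TreeWalk in
theorem mainTheorem3_general {V : Type*} [MeasurableSpace V] [DiscreteMeasurableSpace V]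
    {G : SimpleGraph V} [G.LocallyFinite] (hG : G.Preconnected) {r u u' : V}
    (hu : u ∉ descendants G r u') (hu' : u' ∉ descendants G r u)
    (h_trans : Transient (G.induce (descendants G r u)))
    (h_trans' : Transient (G.induce (descendants G r u'))) (x : V) : BoundaryNontrivial G x :=
  have h_pos {w : V} (hw : Transient (G.induce (descendants G r w))) :
      0 < law G x (eventuallyIn (descendants G r w)) :=
    law_eventuallyIn_pos hG self_mem_descendants
      (fun _ hy hne _ => mem_descendants_of_adj hy hne) hw x
  boundaryNontrivial_of_disjoint (disjoint_descendants hG hu hu') (h_pos h_trans) (h_pos h_trans')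

theorem mainTheorem3 {V : Type*} [MeasurableSpace V] [DiscreteMeasurableSpace V]
    (T : SimpleGraph V) [T.LocallyFinite] (hT : T.IsTree) (v : V) (hv : 2 ≤ T.degree v)
    (htrans : ∀ u : V, T.Adj v u →
      TreeWalk.Transient (T.induce (TreeWalk.descendants T v u))) :
    ∀ x : V, TreeWalk.BoundaryNontrivial T x := by
  obtain ⟨u, u', hu, hu', hne⟩ := TreeWalk.exists_adj_ne_of_two_le_degree hv
  exact mainTheorem3_general hT.connected.preconnected
    (TreeWalk.notMem_descendants_of_adj hu hu'.ne hne)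
    (TreeWalk.notMem_descendants_of_adj hu' hu.ne hne.symm) (htrans u hu) (htrans u' hu')
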